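/- Let $R$ be a Dedekind domain with fraction field $F$ of characteristic different from $2$, and let $(V,f)$ be a nondegenerate quadratic space over $F$ with $\dim V\ge 3$. For each maximal ideal (place) $\mathfrak p\neq 0$ of $R$ let $\widehat R_{\mathfrak p}$ be the completion of $R$ at $\mathfrak p$, $F_{\mathfrak p}$ its fraction field, and $V_{\mathfrak p}=F_{\mathfrak p}\otimes_F V$. Let $L$ be a lattice on $V$, i.e. a finitely generated $R$-submodule of $V$ spanning $V$ over $F$, and put $L_{\mathfrak p}=\widehat R_{\mathfrak p}L\subseteq V_{\mathfrak p}$. Write $\mathrm O^+(V)$ for the special orthogonal group of $V$ (isometries of determinant $1$), and $$\mathrm O^+_{\mathbf A}(V)=\Big\{(\sigma_{\mathfrak p})\in\prod_{\mathfrak p}\mathrm O^+(V_{\mathfrak p})\ :\ \sigma_{\mathfrak p}L_{\mathfrak p}=L_{\mathfrak p}\text{ for almost all }\mathfrak p\Big\},$$ which contains $\mathrm O^+(V)$ diagonally. For $\sigma\in \mathrm O^+_{\mathbf A}(V)$ let $\sigma L$ be the lattice $K$ on $V$ with $K_{\mathfrak p}=\sigma_{\mathfrak p}L_{\mathfrak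 p}$ for all $\mathfrak p$. Let $\mathbf I_F$ be the idèle group, the restricted product of the $F_{\mathfrak p}^\times$ relative to the $\widehat R_{\mathfrak p}^\times$, and let $\mathrm O'_{\mathbf A}(V)$ be the kernel of the adelic spinor norm $\theta_{\mathbf A}:\mathrm O^+_{\mathbf A}(V)\to \mathbf I_F/\mathbf I_F^2$ induced by the local spinor norms $\theta_{\mathfrak p}:\mathrm O^+(V_{\mathfrak p})\to F_{\mathfrak p}^\times/F_{\mathfrak p}^{\times 2}$. The proper class $\mathrm{cls}^+(L)$, the proper spinor genus $\mathrm{spn}^+(L)$ and the genus $\mathrm{gen}(L)$ are the orbits of $L$ under $\mathrm O^+(V)$, $\mathrm O^+(V)\mathrm O'_{\mathbf A}(V)$ and $\mathrm O^+_{\mathbf A}(V)$ respectively; $h^+(L)$ and $g^+(L)$, in $\mathbb N\cup\{\infty\}$, are the numbers of proper classes and of proper spinor genera contained in $\mathrm{gen}(L)$. Let $G=\mathbf{Spin}(V)$ and suppose that $G$ satisfies strong approximation over $R$, i.e. that the diagonal image of $G(F)$ is dense in the adelic space $G(\mathbf A_F)$, the restricted topological product, over all places $\mathfrak p$, of the $G(F_{\mathfrak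 p})$ (with their $\mathfrak p$-adic topologies) relative to the $G(\widehat R_{\mathfrak p})$ (defined for almost all $\mathfrak p$ by an integral model). Then $$\mathrm{cls}^+(L)=\mathrm{spn}^+(L),\qquad\text{and hence}\qquad h^+(L)=g^+(L).$$ -/

import Mathlib

open IsDedekindDomain IsDedekindDomain.HeightOneSpectrum
open scoped TensorProduct RestrictedProduct

noncomputable section

namespace QuadLattice

/-! ### Special orthogonal group and spinor norm over a field -/

section General

variable {K W : Type*} [Field K] [AddCommGroup W] [Module K W]

/-- The group `O⁺(W)` of `K`-points of the special orthogonal group of `(W, Q)`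
(characteristic different from 2): the isometries of determinant one. -/
def specialOrthogonal (Q : QuadraticForm K W) : Subgroup (W ≃ₗ[K] W) where
  carrier := {σ | (∀ x, Q (σ x) = Q x) ∧ LinearEquiv.det σ = 1}
  mul_mem' := by
    rintro σ τ ⟨h1, h2⟩ ⟨h3, h4⟩
    exact ⟨fun x => by rw [LinearEquiv.mul_apply, h1, h3], by rw [map_mul, h2, h4, one_mul]⟩
  one_mem' := ⟨fun _ => rfl, map_one _⟩
  inv_mem' := by
    rintro σ ⟨h1, h2⟩
    refine ⟨fun x => ?_, by rw [map_inv, h2, inv_one]⟩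
    rw [← h1 (σ⁻¹ x), ← LinearEquiv.mul_apply, mul_inv_cancel]
    rfl

/-- The symmetry `τ_u : x ↦ x - (B(u, x) / Q(u)) u`, where `B(u, x) = Q(u + x) - Q(u) - Q(x)`.
It is only used for vectors `u` with `Q u ≠ 0`. -/
def symmetry (Q : QuadraticForm K W) (u : W) : Module.End K W :=
  LinearMap.id - ((Q u)⁻¹ • QuadraticMap.polarBilin Q u).smulRight u

/-- The spinor norm `θ(σ)` of `σ`, regarded as a subset of `Kˣ` (a coset of the subgroup of
squares): if `σ = τ_{u₁} ⋯ τ_{uᵣ}` with all `Q(uᵢ) ≠ 0`, then `θ(σ)` is the square class of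
`Q(u₁) ⋯ Q(uᵣ)`. -/
def spinorNorm (Q : QuadraticForm K W) (σ : specialOrthogonal Q) : Set Kˣ :=
  {a | ∃ us : List W, (∀ u ∈ us, Q u ≠ 0) ∧
    ((σ : W ≃ₗ[K] W) : Module.End K W) = (us.map (symmetry Q)).prod ∧
    ∃ c : Kˣ, (a : K) = (us.map Q).prod * (c : K) ^ 2}

end General

variable {R F V : Type*} [CommRing R] [IsDedekindDomain R] [Field F] [Algebra R F]
  [IsFractionRing R F] [AddCommGroup V] [Module F V]

/-! ### Local completions of spaces and lattices -/

/-- The completion `V_v = F_v ⊗ V` at the place `v`. -/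
abbrev LocalSpace (F V : Type*) [Field F] [Algebra R F] [IsFractionRing R F] [AddCommGroup V]
    [Module F V] (v : HeightOneSpectrum R) : Type _ :=
  v.adicCompletion F ⊗[F] V

/-- The local lattice `L_v = R̂_v L` in `V_v`: the `R̂_v`-span of the image of `L`. -/
def localLattice [Module R V] (L : Submodule R V) (v : HeightOneSpectrum R) :
    Submodule (v.adicCompletionIntegers F) (LocalSpace F V v) :=
  Submodule.span (v.adicCompletionIntegers F)
    ((fun x : V => (1 : v.adicCompletion F) ⊗ₜ[F] x) '' (L : Set V))

variable [Invertible (2 : F)]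

/-- The quadratic form on `V_v` extending `Q`. -/
abbrev localForm (Q : QuadraticForm F V) (v : HeightOneSpectrum R) :
    QuadraticForm (v.adicCompletion F) (LocalSpace F V v) :=
  Q.baseChange (v.adicCompletion F)

lemma baseChange_apply_isometry (Q : QuadraticForm F V) (v : HeightOneSpectrum R)
    (σ : V ≃ₗ[F] V) (hσ : ∀ x, Q (σ x) = Q x) (y : LocalSpace F V v) :
    localForm Q v (σ.baseChange F (v.adicCompletion F) V V y) = localForm Q v y := by
  let f := σ.baseChange F (v.adicCompletion F) V V
  let _ : Invertible (2 : v.adicCompletion F) :=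
    (Invertible.map (algebraMap F (v.adicCompletion F)) 2).copy 2 (map_ofNat _ _).symm
  suffices h : (localForm Q v).comp (f : LocalSpace F V v →ₗ[v.adicCompletion F] _) =
      localForm Q v from DFunLike.congr_fun h y
  have hQ : Q.comp (σ : V →ₗ[F] V) = Q := QuadraticMap.ext hσ
  refine (QuadraticMap.associated_rightInverse (v.adicCompletion F)).injective ?_
  rw [QuadraticMap.associated_comp, QuadraticForm.associated_baseChange]
  conv_rhs => rw [← hQ, QuadraticMap.associated_comp]
  ext x y
  simp [f]

/-- The diagonal map `O⁺(V) → ∏_v O⁺(V_v)`. -/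
def diagonal [FiniteDimensional F V] (Q : QuadraticForm F V) (σ : specialOrthogonal Q)
    (v : HeightOneSpectrum R) : specialOrthogonal (localForm Q v) :=
  ⟨(σ : V ≃ₗ[F] V).baseChange F (v.adicCompletion F) V V,
    baseChange_apply_isometry Q v _ σ.2.1, by
      rw [LinearEquiv.det_baseChange, σ.2.2, map_one]⟩

variable [Module R V]

/-- The image `σ L_v ⊆ V_v` of the local lattice `L_v` under `σ ∈ O⁺(V_v)`. -/
def localImage (Q : QuadraticForm F V) (L : Submodule R V) (v : HeightOneSpectrum R)
    (σ : specialOrthogonal (localForm Q v)) :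
    Submodule (v.adicCompletionIntegers F) (LocalSpace F V v) :=
  (localLattice L v).map
    (((σ : LocalSpace F V v ≃ₗ[v.adicCompletion F] LocalSpace F V v) :
      LocalSpace F V v →ₗ[v.adicCompletion F] LocalSpace F V v).restrictScalars
        (v.adicCompletionIntegers F))

/-! ### Adelic points of the special orthogonal group -/

lemma localImage_one (Q : QuadraticForm F V) (L : Submodule R V) (v : HeightOneSpectrum R) :
    localImage Q L v 1 = localLattice L v :=
  Submodule.map_id _

lemma localImage_mul (Q : QuadraticForm F V) (L : Submodule R V) (v : HeightOneSpectrum R)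
    (σ τ : specialOrthogonal (localForm Q v)) (h : localImage Q L v τ = localLattice L v) :
    localImage Q L v (σ * τ) = localImage Q L v σ := by
  conv_rhs => rw [localImage, ← h, localImage, ← Submodule.map_comp]
  rfl

/-- The group `O⁺_A(V)` of families `(σ_v)` with `σ_v ∈ O⁺(V_v)` for all places `v` and
`σ_v L_v = L_v` for almost all `v`. -/
def adelicSpecialOrthogonal (Q : QuadraticForm F V) (L : Submodule R V) :
    Subgroup (∀ v : HeightOneSpectrum R, specialOrthogonal (localForm Q v)) where
  carrier := {σ | ∀ᶠ v in Filter.cofinite, localImage Q L v (σ v) = localLattice L v}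
  one_mem' := by
    change ∀ᶠ v in Filter.cofinite, localImage Q L v 1 = localLattice L v
    exact Filter.Eventually.of_forall fun v => localImage_one Q L v
  mul_mem' := by
    intro σ τ hσ hτ
    rw [Set.mem_ofPred_eq] at hσ hτ ⊢
    filter_upwards [hσ, hτ] with v h1 h2
    rw [Pi.mul_apply, localImage_mul Q L v _ _ h2, h1]
  inv_mem' := by
    intro σ hσ
    rw [Set.mem_ofPred_eq] at hσ ⊢
    filter_upwards [hσ] with v h
    rw [Pi.inv_apply, ← localImage_mul Q L v _ _ h, inv_mul_cancel, localImage_one]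

/-! ### Classes, genera and spinor genera -/

/-- The idèle group of `F` over `R`: the restricted product of the groups `F_vˣ` relative to the
groups `R̂_vˣ`. -/
abbrev IdeleGroup (R F : Type*) [CommRing R] [IsDedekindDomain R] [Field F] [Algebra R F]
    [IsFractionRing R F] : Type _ :=
  Πʳ v : HeightOneSpectrum R,
    [(v.adicCompletion F)ˣ, (Submonoid.ofClass (v.adicCompletionIntegers F)).units]

/-- The adelic spinor norm `θ_A(σ) ∈ I_F / I_F²` of a family `σ`, regarded as a subset of the
idèle group `I_F` (a coset of `I_F²`): the idèles `a` with `a_v ∈ θ_v(σ_v)` for all `v`. -/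
def adelicSpinorNorm (Q : QuadraticForm F V)
    (σ : ∀ v : HeightOneSpectrum R, specialOrthogonal (localForm Q v)) :
    Set (IdeleGroup R F) :=
  {a | ∀ v, a v ∈ spinorNorm (localForm Q v) (σ v)}

/-- `O'_A(V)`, the kernel of the adelic spinor norm on `O⁺_A(V)`: the elements whose spinor norm
is the trivial coset of `I_F²`. -/
def adelicSpinorKernel (Q : QuadraticForm F V) (L : Submodule R V) :
    Set (∀ v : HeightOneSpectrum R, specialOrthogonal (localForm Q v)) :=
  {σ | σ ∈ adelicSpecialOrthogonal Q L ∧ 1 ∈ adelicSpinorNorm Q σ}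

variable [IsScalarTower R F V]

/-- `K = σ L`: `K` is the lattice on `V` such that `K_v = σ_v L_v` for all places `v`. -/
def IsTranslate (Q : QuadraticForm F V) (L K : Submodule R V)
    (σ : ∀ v : HeightOneSpectrum R, specialOrthogonal (localForm Q v)) : Prop :=
  K.IsLattice F ∧ ∀ v, localLattice K v = localImage Q L v (σ v)

/-- The proper class `cls⁺(L)`: the orbit of `L` under `O⁺(V)`. -/
def properClass (Q : QuadraticForm F V) (L : Submodule R V) : Set (Submodule R V) :=
  {K | ∃ σ : specialOrthogonal Q,
    K = L.map (((σ : V ≃ₗ[F] V) : V →ₗ[F] V).restrictScalars R)}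

/-- The genus `gen(L)`: the orbit of `L` under `O⁺_A(V)`. -/
def genus (Q : QuadraticForm F V) (L : Submodule R V) : Set (Submodule R V) :=
  {K | ∃ σ ∈ adelicSpecialOrthogonal Q L, IsTranslate Q L K σ}

/-- The proper spinor genus `spn⁺(L)`: the orbit of `L` under the subgroup `O⁺(V) O'_A(V)` of
`O⁺_A(V)`. -/
def properSpinorGenus [FiniteDimensional F V] (Q : QuadraticForm F V) (L : Submodule R V) : Set (Submodule R V) :=
  {K | ∃ σ : specialOrthogonal Q, ∃ γ ∈ adelicSpinorKernel Q L,
    IsTranslate Q L K (diagonal Q σ * γ)}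

/-- The proper class number `h⁺(L)`: the number of proper classes in the genus of `L`. -/
def properClassNumber (Q : QuadraticForm F V) (L : Submodule R V) : ℕ∞ :=
  (properClass Q '' genus Q L).encard

/-- The proper spinor class number `g⁺(L)`: the number of proper spinor genera in the genus
of `L`. -/
def properSpinorClassNumber [FiniteDimensional F V] (Q : QuadraticForm F V)
    (L : Submodule R V) : ℕ∞ :=
  (properSpinorGenus Q '' genus Q L).encard

/-! ### Strong approximation for the spin group -/

/-- The group `G(F_v)` of `F_v`-points of `G = Spin(V)`, inside the Clifford algebra of `V_v`. -/
def LocalSpin (Q : QuadraticForm F V) (v : HeightOneSpectrum R) : Type _ :=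
  spinGroup (localForm Q v)

/-- The Clifford algebra element underlying a point of `G(F_v)`. -/
def LocalSpin.val {Q : QuadraticForm F V} {v : HeightOneSpectrum R} (g : LocalSpin Q v) :
    CliffordAlgebra (localForm Q v) :=
  Subtype.val g

/-- The `v`-adic topology on `G(F_v)`: the subspace topology from the Clifford algebra of `V_v`,
a finite-dimensional `F_v`-vector space with its canonical topology. -/
instance (Q : QuadraticForm F V) (v : HeightOneSpectrum R) : TopologicalSpace (LocalSpin Q v) :=
  TopologicalSpace.induced LocalSpin.val
    (moduleTopology (v.adicCompletion F) (CliffordAlgebra (localForm Q v)))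

/-- The `R̂_v`-points of the integral model of `G` attached to the lattice `L`: the elements of
`G(F_v)` in the `R̂_v`-subalgebra of the Clifford algebra generated by `L_v`. -/
def localSpinIntegral (Q : QuadraticForm F V) (L : Submodule R V) (v : HeightOneSpectrum R) :
    Set (LocalSpin Q v) :=
  {g | g.val ∈ Algebra.adjoin (v.adicCompletionIntegers F)
    (CliffordAlgebra.ι (localForm Q v) '' (localLattice (F := F) L v : Set (LocalSpace F V v)))}

/-- The adelic space `G(A_F)` over `R` with the adelic topology: the restricted topological
product of the `G(F_v)` relative to the open subsets `G(R̂_v)`. -/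
abbrev AdelicSpin (Q : QuadraticForm F V) (L : Submodule R V) : Type _ :=
  Πʳ v : HeightOneSpectrum R, [LocalSpin Q v, localSpinIntegral Q L v]

/-- The diagonal image of `G(F)` in `G(A_F)`. -/
def diagonalSpin (Q : QuadraticForm F V) (L : Submodule R V) : Set (AdelicSpin Q L) :=
  {g | ∃ x ∈ spinGroup Q, ∀ v, (g v).val =
    CliffordAlgebra.ofBaseChange (v.adicCompletion F) Q (1 ⊗ₜ[F] x)}

variable (R) in
/-- `G = Spin(V)` satisfies strong approximation over `R`: the diagonal image of `G(F)` is dense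
in `G(A_F)`. Two lattices on `V` have the same completions at almost all places, so the adelic
space and its topology do not depend on the lattice `L` used to describe the integral points. -/
def SpinStrongApproximation (Q : QuadraticForm F V) : Prop :=
  ∃ L : Submodule R V, L.IsLattice F ∧ Dense (diagonalSpin Q L)

end QuadLattice

end

/-! The essential inclusion is that a spinor genus lies in a class: for `γ` in the adelic spinor
kernel, some global rotation `σ` must satisfy `σ L_v = γ_v L_v` at every place. Since lattices are
determined by their completions, `α γ L = α σ L` then lies in the class of `L` for every global
rotation `α`.

To find `σ`, lift each `γ_v` to the local spin group: trivial spinor norm means that `γ_v` is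
conjugation by a product of vectors of norm 1 (`exists_mem_spinGroup_of_one_mem_spinorNorm`). Strong
approximation then gives one global spin element subject to two kinds of open conditions, and `σ` is
conjugation by it.

At finitely many bad places it is close to the lift of `γ_v`; the action on a finitely generated
lattice is locally constant, so `σ L_v = γ_v L_v` (`exists_isOpen_forall_localImage_eq`). At the
remaining places `γ_v L_v = L_v` and `L_v` is integral and self-dual; there it is only required to
be an integral point, and integral points stabilize such a lattice
(`localImage_eq_of_mem_localSpinIntegral`), because the order generated by `L_v` in the Clifford
algebra is a finite module and so contains only integral scalars. -/

noncomputable section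

namespace QuadLattice

/-! ### Symmetries, products of vectors and the spin group over a field. -/

section Field

variable {K W : Type*} [Field K] [AddCommGroup W] [Module K W] (Q : QuadraticForm K W)

open CliffordAlgebra

lemma symmetry_apply (u x : W) :
    symmetry Q u x = x - ((Q u)⁻¹ * QuadraticMap.polar Q u x) • u := by
  simp [symmetry]

lemma symmetry_smul (c : K) (hc : c ≠ 0) (u : W) : symmetry Q (c • u) = symmetry Q u := by
  by_cases hu : Q u = 0
  · ext x
    simp [symmetry_apply, QuadraticMap.map_smul, hu]
  ext x
  simp only [symmetry_apply, QuadraticMap.map_smul, QuadraticMap.polar_smul_left, smul_smul,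
    smul_eq_mul]
  congr 2
  field_simp

lemma det_symmetry [FiniteDimensional K W] {u : W} (hu : Q u ≠ 0) :
    LinearMap.det (symmetry Q u) = -1 := by
  have h : symmetry Q u =
      LinearMap.transvection (-((Q u)⁻¹ • QuadraticMap.polarBilin Q u)) u := by
    ext x
    simp [symmetry_apply, LinearMap.transvection.apply, sub_eq_add_neg]
  rw [h, LinearMap.transvection.det]
  simp only [LinearMap.neg_apply, LinearMap.smul_apply, QuadraticMap.polarBilin_apply_apply,
    QuadraticMap.polar_self, smul_eq_mul, nsmul_eq_mul]
  field_simp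
  norm_num

lemma map_symmetry {u : W} (hu : Q u ≠ 0) (x : W) : Q (symmetry Q u x) = Q x := by
  rw [symmetry_apply, sub_eq_add_neg, ← neg_smul, QuadraticMap.map_add Q,
    QuadraticMap.map_smul, QuadraticMap.polar_smul_right, QuadraticMap.polar_comm Q x u]
  simp only [smul_eq_mul]
  field_simp
  ring

/-- Conjugation by `u` is the negative of the symmetry, but `star` also negates vectors, so the
signs cancel and only the factor `Q u` remains. -/
lemma ι_mul_ι_mul_star_ι {u : W} (hu : Q u ≠ 0) (x : W) :
    ι Q u * ι Q x * star (ι Q u) = Q u • ι Q (symmetry Q u x) := by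
  have h : ι Q u * ι Q x = algebraMap K _ (QuadraticMap.polar Q u x) - ι Q x * ι Q u :=
    eq_sub_of_add_eq (ι_mul_ι_add_swap u x)
  rw [star_ι, mul_neg, h, sub_mul, mul_assoc, ι_sq_scalar, symmetry_apply, map_sub, map_smul,
    smul_sub, smul_smul, mul_inv_cancel_left₀ hu, ← Algebra.commutes, ← Algebra.smul_def,
    ← Algebra.smul_def, neg_sub]

/-- The product in the Clifford algebra of a list of vectors. -/
def vectorProd (us : List W) : CliffordAlgebra Q := (us.map (ι Q)).prod

lemma vectorProd_cons (u : W) (us : List W) :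
    vectorProd Q (u :: us) = ι Q u * vectorProd Q us := by simp [vectorProd]

lemma vectorProd_append (us ws : List W) :
    vectorProd Q (us ++ ws) = vectorProd Q us * vectorProd Q ws := by simp [vectorProd]

/-- The factor represents the spinor norm; once it is normalized to 1, twisted conjugation is
exactly the product of symmetries. -/
lemma vectorProd_mul_ι_mul_star {us : List W} (hus : ∀ u ∈ us, Q u ≠ 0) (x : W) :
    vectorProd Q us * ι Q x * star (vectorProd Q us) =
      (us.map Q).prod • ι Q ((us.map (symmetry Q)).prod x) := by
  induction us with
  | nil => simp [vectorProd]
  | cons u us ih =>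
    rw [List.forall_mem_cons] at hus
    rw [vectorProd_cons, star_mul]
    have : ι Q u * vectorProd Q us * ι Q x * (star (vectorProd Q us) * star (ι Q u)) =
        ι Q u * (vectorProd Q us * ι Q x * star (vectorProd Q us)) * star (ι Q u) := by
      simp only [mul_assoc]
    rw [this, ih hus.2, mul_smul_comm, smul_mul_assoc, ι_mul_ι_mul_star_ι Q hus.1, smul_smul]
    simp [mul_comm]

lemma vectorProd_mul_star (us : List W) :
    vectorProd Q us * star (vectorProd Q us) =
      algebraMap K _ ((-1) ^ us.length * (us.map Q).prod) := by
  induction us with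
  | nil => simp [vectorProd]
  | cons u us ih =>
    rw [vectorProd_cons, star_mul]
    have : ι Q u * vectorProd Q us * (star (vectorProd Q us) * star (ι Q u)) =
        ι Q u * (vectorProd Q us * star (vectorProd Q us)) * star (ι Q u) := by
      simp only [mul_assoc]
    rw [this, ih, ← Algebra.commutes, mul_assoc, star_ι, mul_neg, ι_sq_scalar, ← map_neg,
      ← map_mul]
    congr 1
    simp only [List.length_cons, List.map_cons, List.prod_cons]
    ring

lemma involute_vectorProd (us : List W) :
    involute (vectorProd Q us) = (-1 : K) ^ us.length • vectorProd Q us := by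
  rw [vectorProd, involute_prod_map_ι]

lemma vectorProd_mem_evenOdd (us : List W) :
    vectorProd Q us ∈ evenOdd Q (us.length : ZMod 2) := by
  induction us with
  | nil => simpa [vectorProd] using Submodule.one_le.mp (one_le_evenOdd_zero Q)
  | cons u us ih =>
    rw [vectorProd_cons, List.length_cons, Nat.cast_succ, add_comm]
    exact SetLike.mul_mem_graded (ι_mem_evenOdd_one Q u) ih

lemma det_prod_symmetry [FiniteDimensional K W] {us : List W} (hus : ∀ u ∈ us, Q u ≠ 0) :
    LinearMap.det (us.map (symmetry Q)).prod = (-1) ^ us.length := by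
  induction us with
  | nil => simp
  | cons u us ih =>
    rw [List.forall_mem_cons] at hus
    simp [ih hus.2, det_symmetry Q hus.1, pow_succ]

lemma map_prod_symmetry {us : List W} (hus : ∀ u ∈ us, Q u ≠ 0) (x : W) :
    Q ((us.map (symmetry Q)).prod x) = Q x := by
  induction us with
  | nil => simp
  | cons u us ih =>
    rw [List.forall_mem_cons] at hus
    simp [map_symmetry Q hus.1, ih hus.2]

/-- The inverse of an invertible vector `a` is again a vector, `a / Q a`, so inverses of generators
cost nothing. -/
lemma exists_vectorProd_of_mem_lipschitzGroup {x : (CliffordAlgebra Q)ˣ}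
    (hx : x ∈ lipschitzGroup Q) :
    ∃ us : List W, (∀ u ∈ us, Q u ≠ 0) ∧ (x : CliffordAlgebra Q) = vectorProd Q us := by
  rcases subsingleton_or_nontrivial (CliffordAlgebra Q) with h | h
  · exact ⟨[], by simp, Subsingleton.elim _ _⟩
  have key : ∀ (x : (CliffordAlgebra Q)ˣ) (a : W), ι Q a = x → Q a ≠ 0 := by
    rintro x a ha h0
    have h1 := ι_sq_scalar Q a
    rw [h0, map_zero, ha, ← Units.val_mul] at h1
    exact (x * x).ne_zero h1
  induction hx using Subgroup.closure_induction'' with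
  | mem x hx =>
    obtain ⟨a, ha⟩ := hx
    exact ⟨[a], by simpa using key x a ha, by simp [vectorProd, ha]⟩
  | inv_mem x hx =>
    obtain ⟨a, ha⟩ := hx
    have h0 := key x a ha
    refine ⟨[(Q a)⁻¹ • a], by simp [QuadraticMap.map_smul, h0], ?_⟩
    refine Units.inv_eq_of_mul_eq_one_right ?_
    simp [vectorProd, ← ha, ι_sq_scalar, Algebra.algebraMap_eq_smul_one, smul_smul, h0]
  | one => exact ⟨[], by simp, by simp [vectorProd]⟩
  | mul y z _ _ hy hz =>
    obtain ⟨us, h1, h2⟩ := hy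
    obtain ⟨ws, h3, h4⟩ := hz
    refine ⟨us ++ ws, ?_, by rw [vectorProd_append, Units.val_mul, h2, h4]⟩
    intro u hu
    rcases List.mem_append.1 hu with h | h
    exacts [h1 u h, h3 u h]

variable [Invertible (2 : K)]

lemma ι_injective : Function.Injective (ι Q) := by
  intro x y h
  have h1 := congrArg (equivExterior Q) h
  simp only [equivExterior, changeFormEquiv_apply, changeForm_ι] at h1
  exact (ExteriorAlgebra.ι_leftInverse (R := K) (M := W)).injective h1

instance : Nontrivial (CliffordAlgebra Q) := (equivExterior Q).toEquiv.nontrivial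

lemma even_of_neg_one_pow_eq_one {n : ℕ} (h : (-1 : K) ^ n = 1) : Even n := by
  by_contra hn
  rw [(Nat.not_even_iff_odd.1 hn).neg_one_pow] at h
  have h2 : (2 : K) ≠ 0 := Invertible.ne_zero 2
  apply h2
  linear_combination -h

variable {Q} in
/-- The spin group acts on the quadratic space by conjugation through the special orthogonal
group. -/
lemma exists_specialOrthogonal_of_mem_spinGroup [FiniteDimensional K W]
    {x : CliffordAlgebra Q} (hx : x ∈ spinGroup Q) :
    ∃ σ : specialOrthogonal Q, ∀ y, x * ι Q y * star x = ι Q ((σ : W ≃ₗ[K] W) y) := by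
  obtain ⟨⟨⟨z, hz, rfl⟩, -, hstar⟩, -⟩ := id hx
  obtain ⟨us, hus, h⟩ := exists_vectorProd_of_mem_lipschitzGroup Q hz
  simp only [Units.coeHom_apply] at hx hstar ⊢
  -- A spin element is nonzero and fixed by the involution, which multiplies a product of `n`
  -- vectors by `(-1) ^ n`; hence this sign is 1. Then `x * star x = 1` forces the product of the
  -- norms to be 1.
  have hinv := spinGroup.involute_eq hx
  rw [h, involute_vectorProd] at hinv
  have heven : (-1 : K) ^ us.length = 1 := by
    by_contra hne
    have h0 : ((-1 : K) ^ us.length - 1) • vectorProd Q us = 0 := by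
      rw [sub_smul, hinv, one_smul, sub_self]
    rw [smul_eq_zero, sub_eq_zero, or_iff_right hne, ← h] at h0
    exact z.ne_zero h0
  rw [h] at hstar ⊢
  rw [vectorProd_mul_star, heven, one_mul, ← map_one (algebraMap K (CliffordAlgebra Q))] at hstar
  have hprod := FaithfulSMul.algebraMap_injective K (CliffordAlgebra Q) hstar
  have hdet := det_prod_symmetry Q hus
  rw [heven] at hdet
  refine ⟨⟨LinearEquiv.ofIsUnitDet (f := (us.map (symmetry Q)).prod) (v := Module.finBasis K W)
    (v' := Module.finBasis K W) ?_, fun y => ?_, ?_⟩, fun y => ?_⟩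
  · rw [LinearMap.det_toMatrix, hdet]; exact isUnit_one
  · exact map_prod_symmetry Q hus y
  · rw [← Units.val_inj, LinearEquiv.coe_det]
    exact hdet
  · rw [vectorProd_mul_ι_mul_star Q hus, hprod, one_smul]
    rfl

variable {Q} in
/-- Elements of the special orthogonal group of trivial spinor norm lift to the spin group. -/
lemma exists_mem_spinGroup_of_one_mem_spinorNorm [FiniteDimensional K W]
    {σ : specialOrthogonal Q} (hσ : 1 ∈ spinorNorm Q σ) :
    ∃ x ∈ spinGroup Q, ∀ y, x * ι Q y * star x = ι Q ((σ : W ≃ₗ[K] W) y) := by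
  obtain ⟨us, hus, hσus, c, hc⟩ := hσ
  -- Rescaling one vector by `c` leaves its symmetry unchanged and multiplies the product of norms
  -- by `c ^ 2`, making it exactly 1. The empty product is already 1.
  obtain ⟨ws, hws, hσws, hprod⟩ : ∃ ws : List W, (∀ u ∈ ws, Q u ≠ 0) ∧
      ((σ : W ≃ₗ[K] W) : Module.End K W) = (ws.map (symmetry Q)).prod ∧ (ws.map Q).prod = 1 := by
    cases us with
    | nil => exact ⟨[], by simp, hσus, by simp⟩
    | cons u us =>
      refine ⟨(c : K) • u :: us, ?_, ?_, ?_⟩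
      · rw [List.forall_mem_cons] at hus ⊢
        exact ⟨by simp [QuadraticMap.map_smul, hus.1], hus.2⟩
      · rw [hσus, List.map_cons, List.map_cons, symmetry_smul Q _ c.ne_zero]
      · simp only [List.map_cons, List.prod_cons, QuadraticMap.map_smul, smul_eq_mul,
          Units.val_one] at hc ⊢
        rw [hc]; ring
  have hdet := det_prod_symmetry Q hws
  rw [← hσws, ← LinearEquiv.coe_det, σ.2.2, Units.val_one] at hdet
  have hstar : vectorProd Q ws * star (vectorProd Q ws) = 1 := by
    rw [vectorProd_mul_star, ← hdet, hprod, one_mul, map_one]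
  have heven := even_of_neg_one_pow_eq_one hdet.symm
  have hlip : vectorProd Q ws ∈ (lipschitzGroup Q).toSubmonoid.map
      (Units.coeHom <| CliffordAlgebra Q) := by
    refine Submonoid.list_prod_mem _ fun a ha => ?_
    obtain ⟨u, hu, rfl⟩ := List.mem_map.1 ha
    let _ : Invertible (Q u) := invertibleOfNonzero (hws u hu)
    let _ : Invertible (ι Q u) := invertibleιOfInvertible Q u
    exact ⟨unitOfInvertible (ι Q u), Subgroup.subset_closure ⟨u, rfl⟩, rfl⟩
  refine ⟨vectorProd Q ws, ⟨⟨hlip, ?_, hstar⟩, ?_⟩, fun y => ?_⟩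
  -- The product is a unit, so its right inverse `star` is also a left inverse.
  · obtain ⟨z, -, hz⟩ := hlip
    rw [← hz] at hstar ⊢
    change (z : CliffordAlgebra Q) * _ = 1 at hstar
    change _ * (z : CliffordAlgebra Q) = 1
    rw [Units.eq_inv_of_mul_eq_one_left hstar, Units.inv_mul]
  · have h := vectorProd_mem_evenOdd Q ws
    rwa [heven.natCast_zmod_two] at h
  · rw [vectorProd_mul_ι_mul_star Q hws, hprod, one_smul, ← hσws]
    rfl

end Field

/-! ### Finiteness of algebras generated by anticommuting elements, up to scalars. -/

section Adjoin

/-- A finite set whose anticommutators are scalars generates a finite algebra. -/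
lemma fg_adjoin_of_anticommutators {O A : Type*} [CommRing O] [Ring A] [Algebra O A]
    (s : Finset A) (hsq : ∀ a ∈ s, a * a ∈ (algebraMap O A).range)
    (hs : ∀ a ∈ s, ∀ b ∈ s, a * b + b * a ∈ (algebraMap O A).range) :
    (Subalgebra.toSubmodule (Algebra.adjoin O (s : Set A))).FG := by
  classical
  induction s using Finset.induction_on with
  | empty =>
    rw [Finset.coe_empty, Algebra.adjoin_empty, Algebra.toSubmodule_bot]
    rw [Submodule.one_eq_span]
    exact Submodule.fg_span_singleton _
  | insert e s _ ih =>
    have ih := ih (fun a ha => hsq a (Finset.mem_insert_of_mem ha))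
      (fun a ha b hb => hs a (Finset.mem_insert_of_mem ha) b (Finset.mem_insert_of_mem hb))
    set B := Algebra.adjoin O (s : Set A) with hB
    -- The enlarged algebra is `B + B e`: the relations `e b = c - b e` and `e e = r` with `c`, `r`
    -- scalars make this module stable under left multiplication by all generators.
    let N : Submodule O A :=
      Subalgebra.toSubmodule B ⊔ (Subalgebra.toSubmodule B).map (LinearMap.mulRight O e)
    have hNfg : N.FG := ih.sup (ih.map _)
    have hBN : ∀ a ∈ B, a ∈ N := fun a ha => Submodule.mem_sup_left ha
    have hBeN : ∀ a ∈ B, a * e ∈ N := fun a ha =>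
      Submodule.mem_sup_right (Submodule.mem_map_of_mem (f := LinearMap.mulRight O e) ha)
    have hN : ∀ n ∈ N, ∃ a ∈ B, ∃ b ∈ B, n = a + b * e := by
      intro n hn
      obtain ⟨a, ha, _, ⟨b, hb, rfl⟩, rfl⟩ := Submodule.mem_sup.1 hn
      exact ⟨a, ha, b, hb, rfl⟩
    have hBmul : ∀ b ∈ B, ∀ n ∈ N, b * n ∈ N := by
      intro b hb n hn
      obtain ⟨a, ha, c, hc, rfl⟩ := hN n hn
      rw [mul_add, ← mul_assoc]
      exact add_mem (hBN _ (mul_mem hb ha)) (hBeN _ (mul_mem hb hc))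
    have heB : ∀ a ∈ B, e * a ∈ N := by
      intro a ha
      induction ha using Algebra.adjoin_induction with
      | mem b hb =>
        obtain ⟨c, hc⟩ := hs e (Finset.mem_insert_self _ _) b (Finset.mem_insert_of_mem hb)
        rw [eq_sub_of_add_eq hc.symm]
        exact sub_mem (hBN _ (algebraMap_mem B c)) (hBeN _ (Algebra.subset_adjoin hb))
      | algebraMap r =>
        rw [← Algebra.commutes]
        exact hBeN _ (algebraMap_mem B r)
      | add x y _ _ hx hy => rw [mul_add]; exact add_mem hx hy
      | mul x y _ hyB hx hy =>
        obtain ⟨a, ha, c, hc, h⟩ := hN _ hx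
        rw [← mul_assoc, h, add_mul, mul_assoc]
        exact add_mem (hBN _ (mul_mem ha hyB)) (hBmul c hc _ hy)
    have heN : ∀ n ∈ N, e * n ∈ N := by
      intro n hn
      obtain ⟨a, ha, b, hb, rfl⟩ := hN n hn
      obtain ⟨c, hc, d, hd, h⟩ := hN _ (heB b hb)
      obtain ⟨r, hr⟩ := hsq e (Finset.mem_insert_self _ _)
      rw [mul_add, ← mul_assoc, h, add_mul, mul_assoc, ← hr]
      exact add_mem (heB a ha) (add_mem (hBeN c hc) (hBN _ (mul_mem hd (algebraMap_mem B r))))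
    have hle : ∀ x ∈ Algebra.adjoin O ((insert e s : Finset A) : Set A), ∀ n ∈ N, x * n ∈ N := by
      intro x hx
      induction hx using Algebra.adjoin_induction with
      | mem b hb =>
        rcases Finset.mem_insert.1 hb with rfl | hb
        exacts [heN, hBmul b (Algebra.subset_adjoin hb)]
      | algebraMap r => exact hBmul _ (algebraMap_mem B r)
      | add x y _ _ hx hy =>
        intro n hn
        rw [add_mul]
        exact add_mem (hx n hn) (hy n hn)
      | mul x y _ _ hx hy =>
        intro n hn
        rw [mul_assoc]
        exact hx _ (hy n hn)
    have heq : Subalgebra.toSubmodule (Algebra.adjoin O ((insert e s : Finset A) : Set A)) = N := by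
      apply le_antisymm
      · intro x hx
        simpa using hle x hx 1 (hBN 1 (one_mem B))
      · have hBle : B ≤ Algebra.adjoin O ((insert e s : Finset A) : Set A) :=
          Algebra.adjoin_mono (by simp)
        refine sup_le hBle ?_
        rintro _ ⟨b, hb, rfl⟩
        exact mul_mem (S := Subalgebra O A) (hBle hb) (Algebra.subset_adjoin (by simp))
    rw [heq]
    exact hNfg

end Adjoin

/-! ### Orders in the Clifford algebra and integrality. -/

section CliffordOrder

open CliffordAlgebra

variable {O K W : Type*} [CommRing O] [Field K] [Algebra O K] [AddCommGroup W] [Module K W]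
  [Module O W] [IsScalarTower O K W] (Q : QuadraticForm K W)

variable (O) in
/-- The subalgebra of the Clifford algebra generated over `O` by a set of vectors. -/
def cliffordOrder (s : Set W) : Subalgebra O (CliffordAlgebra Q) :=
  Algebra.adjoin O (ι Q '' s)

lemma cliffordOrder_span (s : Set W) :
    cliffordOrder O Q (Submodule.span O s : Set W) = cliffordOrder O Q s := by
  have h : ι Q '' (Submodule.span O s : Set W) = (Submodule.span O (ι Q '' s) : Set _) := by
    have := Submodule.map_span ((ι Q).restrictScalars O) s
    exact congrArg (SetLike.coe) this
  rw [cliffordOrder, h, Algebra.adjoin_span, cliffordOrder]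

lemma fg_cliffordOrder {s : Set W} (hs : s.Finite)
    (hQ : ∀ x ∈ s, Q x ∈ (algebraMap O K).range)
    (hB : ∀ x ∈ s, ∀ y ∈ s, QuadraticMap.polar Q x y ∈ (algebraMap O K).range) :
    (Subalgebra.toSubmodule (cliffordOrder O Q s)).FG := by
  classical
  have h : ι Q '' s = ((hs.image (ι Q)).toFinset : Set _) := by simp
  rw [cliffordOrder, h]
  have key : ∀ c ∈ (algebraMap O K).range,
      algebraMap K (CliffordAlgebra Q) c ∈ (algebraMap O (CliffordAlgebra Q)).range := by
    rintro _ ⟨c, rfl⟩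
    exact ⟨c, IsScalarTower.algebraMap_apply O K _ c⟩
  apply fg_adjoin_of_anticommutators
  · simp only [Set.Finite.mem_toFinset]
    rintro _ ⟨x, hx, rfl⟩
    rw [ι_sq_scalar]
    exact key _ (hQ x hx)
  · simp only [Set.Finite.mem_toFinset]
    rintro _ ⟨x, hx, rfl⟩ _ ⟨y, hy, rfl⟩
    rw [ι_mul_ι_add_swap]
    exact key _ (hB x hx y hy)

instance finite_cliffordAlgebra [FiniteDimensional K W] : Module.Finite K (CliffordAlgebra Q) := by
  -- Over `K` itself the integrality conditions are void.
  have h := fg_cliffordOrder (O := K) Q (Set.finite_range (Module.finBasis K W))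
    (fun x _ => ⟨_, rfl⟩) (fun x _ y _ => ⟨_, rfl⟩)
  rw [← cliffordOrder_span, (Module.finBasis K W).span_eq, cliffordOrder, Submodule.top_coe,
    Set.image_univ, adjoin_range_ι, Algebra.top_toSubmodule] at h
  exact ⟨h⟩

/-- Multiplication by `c` preserves the nonzero finitely generated module `B`, so the determinant
trick applies. -/
lemma isIntegral_of_algebraMap_mem {C : Type*} [Ring C] [Nontrivial C] [Algebra K C] [Algebra O C]
    [IsScalarTower O K C] (B : Subalgebra O C) (hB : (Subalgebra.toSubmodule B).FG) {c : K}
    (hc : algebraMap K C c ∈ B) : IsIntegral O c := by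
  refine isIntegral_of_smul_mem_submodule (Subalgebra.toSubmodule B) ?_ hB c fun n hn => ?_
  · intro h
    exact one_ne_zero ((Submodule.mem_bot O).1 (h ▸ one_mem B : (1 : C) ∈ (⊥ : Submodule O C)))
  · rw [Algebra.smul_def]
    exact mul_mem (S := Subalgebra O C) hc hn

lemma isIntegral_polar_of_mem_cliffordOrder [Invertible (2 : K)] {s : Set W}
    (hs : (Subalgebra.toSubmodule (cliffordOrder O Q s)).FG) {x y : W}
    (hx : ι Q x ∈ cliffordOrder O Q s) (hy : ι Q y ∈ cliffordOrder O Q s) :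
    IsIntegral O (QuadraticMap.polar Q x y) := by
  refine isIntegral_of_algebraMap_mem _ hs (?_ : algebraMap K (CliffordAlgebra Q) _ ∈ _)
  rw [← ι_mul_ι_add_swap]
  exact add_mem (mul_mem hx hy) (mul_mem hy hx)

lemma span_cliffordOrder {s : Set W} (hs : Submodule.span K s = ⊤) :
    Submodule.span K (cliffordOrder O Q s : Set (CliffordAlgebra Q)) = ⊤ := by
  have h : Algebra.adjoin K (ι Q '' s) = ⊤ := by
    have h := cliffordOrder_span (O := K) Q s
    rw [hs, cliffordOrder, Submodule.top_coe, Set.image_univ, adjoin_range_ι] at h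
    exact h.symm
  rw [eq_top_iff, ← Algebra.top_toSubmodule, ← h, Algebra.adjoin_eq_span]
  refine Submodule.span_mono ?_
  exact (Submonoid.closure_le (S := (cliffordOrder O Q s).toSubmonoid)).2 Algebra.subset_adjoin

lemma star_mem_cliffordOrder {s : Set W} {x : CliffordAlgebra Q} (hx : x ∈ cliffordOrder O Q s) :
    star x ∈ cliffordOrder O Q s := by
  unfold cliffordOrder at hx
  induction hx using Algebra.adjoin_induction with
  | mem x hx =>
    obtain ⟨x, hx, rfl⟩ := hx
    rw [star_ι]
    exact neg_mem (Algebra.subset_adjoin ⟨x, hx, rfl⟩)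
  | algebraMap r =>
    rw [IsScalarTower.algebraMap_apply O K (CliffordAlgebra Q) r, star_algebraMap,
      ← IsScalarTower.algebraMap_apply O K (CliffordAlgebra Q) r]
    exact algebraMap_mem _ r
  | add x y _ _ hx hy => rw [star_add]; exact add_mem hx hy
  | mul x y _ _ hx hy => rw [star_mul]; exact mul_mem hy hx

/-- The conjugate `ι Q y` stays in the order, so its anticommutator with any `z ∈ N` is a scalar of
the order, hence integral. Thus `y` pairs integrally with `N`, and self-duality puts it in `N`. -/
lemma mem_of_mul_ι_mul_star_mem [Invertible (2 : K)] [IsIntegrallyClosedIn O K]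
    {N : Submodule O W} (hN : (Subalgebra.toSubmodule (cliffordOrder O Q (N : Set W))).FG)
    (hdual : ∀ x, (∀ y ∈ N, QuadraticMap.polar Q x y ∈ (algebraMap O K).range) → x ∈ N)
    {g : CliffordAlgebra Q} (hg : g ∈ cliffordOrder O Q (N : Set W)) {x y : W} (hx : x ∈ N)
    (hxy : g * ι Q x * star g = ι Q y) : y ∈ N := by
  have hι : ∀ z ∈ N, ι Q z ∈ cliffordOrder O Q (N : Set W) := fun z hz =>
    Algebra.subset_adjoin ⟨z, hz, rfl⟩
  refine hdual y fun z hz => ?_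
  have hy : ι Q y ∈ cliffordOrder O Q (N : Set W) :=
    hxy ▸ mul_mem (mul_mem hg (hι x hx)) (star_mem_cliffordOrder Q hg)
  exact IsIntegrallyClosedIn.isIntegral_iff.1
    (isIntegral_polar_of_mem_cliffordOrder Q hN hy (hι z hz))

end CliffordOrder

/-! ### Openness of spanning submodules. -/

section Topology

/-- A `K`-basis chosen inside `N` gives a box of `O`-integral coordinates in `N`. The box is open
around 0, and a subgroup containing a neighbourhood of 0 is open. -/
lemma isOpen_of_span_eq_top {O K W : Type*} [CommRing O] [Field K] [Algebra O K]
    [TopologicalSpace K] [IsTopologicalRing K]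
    (hO : IsOpen ((algebraMap O K).range : Set K)) [AddCommGroup W] [Module K W]
    [Module.Finite K W] [Module O W] [IsScalarTower O K W]
    [TopologicalSpace W] [IsModuleTopology K W] (N : Submodule O W)
    (hN : Submodule.span K (N : Set W) = ⊤) : IsOpen (N : Set W) := by
  have : IsTopologicalAddGroup W := IsModuleTopology.topologicalAddGroup K W
  obtain ⟨s, hsN, hs, hli⟩ := exists_linearIndependent K (N : Set W)
  rw [hN] at hs
  let b : Module.Basis s K W := Module.Basis.mk hli (by simpa using hs.ge)
  have : Finite s := Module.Finite.finite_basis b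
  have := Fintype.ofFinite s
  have hU : IsOpen (⋂ i, b.coord i ⁻¹' ((algebraMap O K).range : Set K)) :=
    isOpen_iInter_of_finite fun i =>
      hO.preimage (IsModuleTopology.continuous_of_linearMap (b.coord i))
  have hUN : (⋂ i, b.coord i ⁻¹' ((algebraMap O K).range : Set K)) ⊆ N := by
    intro w hw
    rw [← b.sum_repr w]
    refine Submodule.sum_mem N fun i _ => ?_
    obtain ⟨c, hc⟩ := Set.mem_iInter.1 hw i
    rw [Module.Basis.coord_apply] at hc
    rw [← hc, algebraMap_smul]
    exact N.smul_mem c (by simpa [b] using hsN i.2)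
  refine N.toAddSubgroup.isOpen_of_mem_nhds (g := 0) ?_
  exact Filter.mem_of_superset (hU.mem_nhds (Set.mem_iInter.2 fun i => ⟨0, by simp⟩)) hUN

end Topology

/-! ### Lattices and their local completions. -/

section Lattice

variable {R F V : Type*} [CommRing R] [IsDedekindDomain R] [Field F] [Algebra R F]
  [IsFractionRing R F] [AddCommGroup V] [Module F V]

lemma algebraMap_mem_adicCompletionIntegers (v : HeightOneSpectrum R) (c : F) :
    algebraMap F (v.adicCompletion F) c ∈ v.adicCompletionIntegers F ↔ v.valuation F c ≤ 1 := by
  rw [mem_adicCompletionIntegers, ← valuedAdicCompletion_eq_valuation']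
  rfl

lemma mem_range_algebraMap_integers {v : HeightOneSpectrum R} {c : v.adicCompletion F} :
    c ∈ (algebraMap (v.adicCompletionIntegers F) (v.adicCompletion F)).range ↔
      c ∈ v.adicCompletionIntegers F :=
  ⟨fun ⟨x, hx⟩ => hx ▸ x.2, fun h => ⟨⟨c, h⟩, rfl⟩⟩

lemma isOpen_range_algebraMap_integers (v : HeightOneSpectrum R) :
    IsOpen ((algebraMap (v.adicCompletionIntegers F) (v.adicCompletion F)).range :
      Set (v.adicCompletion F)) := by
  have h : ((algebraMap (v.adicCompletionIntegers F) (v.adicCompletion F)).range :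
      Set (v.adicCompletion F)) = (v.adicCompletionIntegers F : Set (v.adicCompletion F)) :=
    Set.ext fun _ => mem_range_algebraMap_integers
  rw [h]
  exact Valued.isOpen_valuationSubring (v.adicCompletion F)

lemma eventually_mem_adicCompletionIntegers (c : F) :
    ∀ᶠ v : HeightOneSpectrum R in Filter.cofinite,
      algebraMap F (v.adicCompletion F) c ∈ v.adicCompletionIntegers F := by
  simp_rw [algebraMap_mem_adicCompletionIntegers]
  refine (HeightOneSpectrum.Support.finite R c).subset fun v hv => ?_
  simpa [Support] using hv

/-- By density of `F` in its completion. The multipliers `e i` will be coordinates, so that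
approximating a coefficient leaves an error with integral coordinates. -/
lemma exists_approx {ι : Type*} [Finite ι] (v : HeightOneSpectrum R) {a : v.adicCompletion F}
    (ha : a ∈ v.adicCompletionIntegers F) (e : ι → v.adicCompletion F) :
    ∃ r : F, algebraMap F _ r ∈ v.adicCompletionIntegers F ∧
      ∀ i, (a - algebraMap F _ r) * e i ∈ v.adicCompletionIntegers F := by
  have hO : IsOpen (v.adicCompletionIntegers F : Set (v.adicCompletion F)) :=
    Valued.isOpen_valuationSubring (v.adicCompletion F)
  have : IsTopologicalRing (v.adicCompletion F) := inferInstance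
  have hc : ∀ i, Continuous fun x => (a - x) * e i := fun i =>
    (continuous_const.sub continuous_id).mul continuous_const
  have hU : IsOpen ((v.adicCompletionIntegers F : Set (v.adicCompletion F)) ∩
      ⋂ i, (fun x => (a - x) * e i) ⁻¹' (v.adicCompletionIntegers F : Set (v.adicCompletion F))) :=
    hO.inter (isOpen_iInter_of_finite fun i => hO.preimage (hc i))
  obtain ⟨r, h1, h2⟩ := (denseRange_algebraMap F v).exists_mem_open hU
    ⟨a, ha, Set.mem_iInter.2 fun i => by simp [zero_mem]⟩
  exact ⟨r, h1, fun i => Set.mem_iInter.1 h2 i⟩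

lemma smul_mem_of_mem_integers {v : HeightOneSpectrum R} {W : Type*} [AddCommGroup W]
    [Module (v.adicCompletion F) W] [Module (v.adicCompletionIntegers F) W]
    [IsScalarTower (v.adicCompletionIntegers F) (v.adicCompletion F) W]
    (N : Submodule (v.adicCompletionIntegers F) W) {c : v.adicCompletion F}
    (hc : c ∈ v.adicCompletionIntegers F) {x : W} (hx : x ∈ N) : c • x ∈ N := by
  have := N.smul_mem ⟨c, hc⟩ hx
  rwa [← algebraMap_smul (v.adicCompletion F)] at this

section LocalForm

variable [Invertible (2 : F)] (Q : QuadraticForm F V)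

lemma localForm_one_tmul (v : HeightOneSpectrum R) (x : V) :
    localForm Q v ((1 : v.adicCompletion F) ⊗ₜ[F] x) = algebraMap F _ (Q x) := by
  rw [localForm, QuadraticForm.baseChange_tmul, mul_one, Algebra.algebraMap_eq_smul_one]

lemma polar_localForm_one_tmul (v : HeightOneSpectrum R) (x y : V) :
    QuadraticMap.polar (localForm Q v) ((1 : v.adicCompletion F) ⊗ₜ[F] x)
      ((1 : v.adicCompletion F) ⊗ₜ[F] y) = algebraMap F _ (QuadraticMap.polar Q x y) := by
  simp only [QuadraticMap.polar, ← TensorProduct.tmul_add, localForm_one_tmul, map_sub]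

end LocalForm

variable [Module R V]

lemma tmul_mem_localLattice {L : Submodule R V} {v : HeightOneSpectrum R} {x : V} (hx : x ∈ L) :
    (1 : v.adicCompletion F) ⊗ₜ[F] x ∈ localLattice (F := F) L v :=
  Submodule.subset_span ⟨x, hx, rfl⟩

lemma span_localLattice {L : Submodule R V} (hL : Submodule.span F (L : Set V) = ⊤)
    (v : HeightOneSpectrum R) :
    Submodule.span (v.adicCompletion F) (localLattice (F := F) L v : Set (LocalSpace F V v)) =
      ⊤ := by
  have h : ∀ x : V, (1 : v.adicCompletion F) ⊗ₜ[F] x ∈ Submodule.span (v.adicCompletion F)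
      (localLattice (F := F) L v : Set (LocalSpace F V v)) := by
    intro x
    have hx : x ∈ Submodule.span F (L : Set V) := hL ▸ Submodule.mem_top
    induction hx using Submodule.span_induction with
    | mem x hx => exact Submodule.subset_span (tmul_mem_localLattice hx)
    | zero => rw [TensorProduct.tmul_zero]; exact zero_mem _
    | add x y _ _ hx hy => rw [TensorProduct.tmul_add]; exact add_mem hx hy
    | smul c x _ hx =>
      rw [TensorProduct.tmul_smul, ← algebraMap_smul (v.adicCompletion F)]
      exact Submodule.smul_mem _ _ hx
  rw [eq_top_iff]
  rintro x -
  induction x using TensorProduct.induction_on with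
  | zero => exact zero_mem _
  | add x y hx hy => exact add_mem hx hy
  | tmul c x =>
    rw [← mul_one c, ← smul_eq_mul, ← TensorProduct.smul_tmul']
    exact Submodule.smul_mem _ _ (h x)

lemma eventually_mem_localLattice {L : Submodule R V} (hL : Submodule.span F (L : Set V) = ⊤)
    (x : V) : ∀ᶠ v : HeightOneSpectrum R in Filter.cofinite,
      (1 : v.adicCompletion F) ⊗ₜ[F] x ∈ localLattice (F := F) L v := by
  have hx : x ∈ Submodule.span F (L : Set V) := hL ▸ Submodule.mem_top
  induction hx using Submodule.span_induction with
  | mem x hx => exact Filter.Eventually.of_forall fun v => tmul_mem_localLattice hx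
  | zero => simp [TensorProduct.tmul_zero]
  | add x y _ _ hx hy =>
    filter_upwards [hx, hy] with v h1 h2
    rw [TensorProduct.tmul_add]
    exact add_mem h1 h2
  | smul c x _ hx =>
    filter_upwards [hx, eventually_mem_adicCompletionIntegers c] with v h1 h2
    rw [TensorProduct.tmul_smul, ← algebraMap_smul (v.adicCompletion F)]
    exact smul_mem_of_mem_integers _ h2 h1

/-- Expand `x` in the base change of a global dual basis `d`: its coefficients are the pairings with
the original basis `b`. Both bases lie in `L_v` for almost all `v`, so the coefficients are integral
and the sum stays in `L_v`. -/
lemma eventually_self_dual [FiniteDimensional F V] [Invertible (2 : F)]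
    {Q : QuadraticForm F V} (hQ : Q.Nondegenerate) {L : Submodule R V}
    (hL : Submodule.span F (L : Set V) = ⊤) :
    ∀ᶠ v : HeightOneSpectrum R in Filter.cofinite, ∀ x : LocalSpace F V v,
      (∀ y ∈ localLattice (F := F) L v, QuadraticMap.polar (localForm Q v) x y ∈
        (algebraMap (v.adicCompletionIntegers F) (v.adicCompletion F)).range) →
      x ∈ localLattice (F := F) L v := by
  have hB : (QuadraticMap.polarBilin Q).Nondegenerate := QuadraticMap.nondegenerate_polar_iff.2 hQ
  let b := Module.finBasis F V
  let d := LinearMap.BilinForm.dualBasis (QuadraticMap.polarBilin Q) hB b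
  have hd := Filter.eventually_all.2 fun i => eventually_mem_localLattice (R := R) hL (d i)
  have hb := Filter.eventually_all.2 fun i => eventually_mem_localLattice (R := R) hL (b i)
  filter_upwards [hd, hb] with v h1 h2 x hx
  have hsum : ∀ x : LocalSpace F V v, x = ∑ i, QuadraticMap.polar (localForm Q v) x
      ((1 : v.adicCompletion F) ⊗ₜ[F] b i) • ((1 : v.adicCompletion F) ⊗ₜ[F] d i) := by
    intro x
    induction x using TensorProduct.induction_on with
    | zero => simp
    | add x y hx hy =>
      simp only [QuadraticMap.polar_add_left, add_smul, Finset.sum_add_distrib]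
      rw [← hx, ← hy]
    | tmul c x =>
      have hc : c ⊗ₜ[F] x = c • ((1 : v.adicCompletion F) ⊗ₜ[F] x) := by
        rw [TensorProduct.smul_tmul', smul_eq_mul, mul_one]
      rw [hc]
      simp only [QuadraticMap.polar_smul_left, smul_assoc, ← Finset.smul_sum,
        polar_localForm_one_tmul, algebraMap_smul, ← TensorProduct.tmul_smul,
        ← TensorProduct.tmul_sum]
      congr 2
      conv_lhs => rw [← d.sum_repr x]
      simp [d, QuadraticMap.polarBilin_apply_apply, LinearMap.BilinForm.dualBasis_repr_apply]
  rw [hsum x]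
  refine Submodule.sum_mem _ fun i _ => smul_mem_of_mem_integers _ ?_ (h1 i)
  exact mem_range_algebraMap_integers.1 (hx _ (h2 i))

variable [IsScalarTower R F V]

lemma localLattice_eq_span {L : Submodule R V} {s : Set V} (hs : Submodule.span R s = L)
    (v : HeightOneSpectrum R) :
    localLattice (F := F) L v = Submodule.span (v.adicCompletionIntegers F)
      ((fun x : V => (1 : v.adicCompletion F) ⊗ₜ[F] x) '' s) := by
  refine le_antisymm (Submodule.span_le.2 ?_)
    (Submodule.span_mono (Set.image_mono (hs ▸ Submodule.subset_span)))
  rintro _ ⟨x, hx, rfl⟩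
  simp only [SetLike.mem_coe] at hx ⊢
  rw [← hs] at hx
  induction hx using Submodule.span_induction with
  | mem x hx => exact Submodule.subset_span ⟨x, hx, rfl⟩
  | zero => rw [TensorProduct.tmul_zero]; exact zero_mem _
  | add x y _ _ hx hy => rw [TensorProduct.tmul_add]; exact add_mem hx hy
  | smul c x _ hx =>
    rw [← algebraMap_smul F, TensorProduct.tmul_smul, ← algebraMap_smul (v.adicCompletion F)]
    refine smul_mem_of_mem_integers _ ?_ hx
    rw [algebraMap_mem_adicCompletionIntegers]
    exact v.valuation_le_one c

lemma eventually_localLattice_le {L M : Submodule R V} (hL : Submodule.span F (L : Set V) = ⊤)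
    (hM : M.FG) : ∀ᶠ v : HeightOneSpectrum R in Filter.cofinite,
      localLattice (F := F) M v ≤ localLattice (F := F) L v := by
  obtain ⟨s, hs⟩ := hM
  have h := (Filter.eventually_all_finset s).2 fun x _ => eventually_mem_localLattice hL x
  filter_upwards [h] with v hv
  rw [localLattice_eq_span hs, Submodule.span_le]
  rintro _ ⟨x, hx, rfl⟩
  exact hv x hx

lemma eventually_localLattice_eq {L M : Submodule R V} (hL : L.IsLattice F) (hM : M.IsLattice F) :
    ∀ᶠ v : HeightOneSpectrum R in Filter.cofinite,
      localLattice (F := F) M v = localLattice (F := F) L v := by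
  filter_upwards [eventually_localLattice_le hL.span_eq_top hM.fg,
    eventually_localLattice_le hM.span_eq_top hL.fg] with v h1 h2
  exact le_antisymm h1 h2

lemma eventually_fg_cliffordOrder [Invertible (2 : F)] (Q : QuadraticForm F V)
    {L : Submodule R V} (hL : L.FG) :
    ∀ᶠ v : HeightOneSpectrum R in Filter.cofinite,
      (Subalgebra.toSubmodule (cliffordOrder (v.adicCompletionIntegers F) (localForm Q v)
        (localLattice (F := F) L v : Set (LocalSpace F V v)))).FG := by
  obtain ⟨s, hs⟩ := hL
  have h1 := (Filter.eventually_all_finset s).2 fun x _ =>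
    eventually_mem_adicCompletionIntegers (R := R) (Q x)
  have h2 := (Filter.eventually_all_finset s).2 fun x _ =>
    (Filter.eventually_all_finset s).2 fun y _ =>
      eventually_mem_adicCompletionIntegers (R := R) (QuadraticMap.polar Q x y)
  filter_upwards [h1, h2] with v h1 h2
  rw [localLattice_eq_span hs, cliffordOrder_span]
  refine fg_cliffordOrder _ (s.finite_toSet.image _) ?_ ?_
  · rintro _ ⟨x, hx, rfl⟩
    rw [mem_range_algebraMap_integers, localForm_one_tmul]
    exact h1 x hx
  · rintro _ ⟨x, hx, rfl⟩ _ ⟨y, hy, rfl⟩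
    rw [mem_range_algebraMap_integers, polar_localForm_one_tmul]
    exact h2 x hx y hy

variable [FiniteDimensional F V]

/-- Descent from the completion to the localization of `L` at `v`: replacing local coefficients by
approximations from `F` changes `y` by a vector with `v`-integral coordinates in a basis contained
in `L`, and both pieces lie in that localization. -/
lemma exists_smul_mem_of_tmul_mem_localLattice {L : Submodule R V} (hL : L.IsLattice F)
    (v : HeightOneSpectrum R) {y : V}
    (hy : (1 : v.adicCompletion F) ⊗ₜ[F] y ∈ localLattice (F := F) L v) :
    ∃ s ∉ v.asIdeal, s • y ∈ L := by
  classical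
  let P : AddSubmonoid V :=
    { carrier := {x | ∃ s ∉ v.asIdeal, s • x ∈ L}
      zero_mem' := ⟨1, fun h => v.isPrime.ne_top ((Ideal.eq_top_iff_one _).2 h), by simp⟩
      add_mem' := by
        rintro x z ⟨s, hs, hx⟩ ⟨t, ht, hz⟩
        refine ⟨s * t, fun h => (v.isPrime.mem_or_mem h).elim hs ht, ?_⟩
        rw [smul_add]
        refine L.add_mem ?_ ?_
        · rw [mul_comm, mul_smul]; exact L.smul_mem _ hx
        · rw [mul_smul]; exact L.smul_mem _ hz }
  have hP : ∀ c : F, algebraMap F (v.adicCompletion F) c ∈ v.adicCompletionIntegers F →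
      ∀ x ∈ L, c • x ∈ P := by
    intro c hc x hx
    rw [algebraMap_mem_adicCompletionIntegers] at hc
    obtain ⟨n, d, hd⟩ := v.exists_primeCompl_mul_eq_of_integer c hc
    refine ⟨d, d.2, ?_⟩
    rw [← algebraMap_smul F, smul_smul, mul_comm, hd, algebraMap_smul]
    exact L.smul_mem _ hx
  obtain ⟨s, hsL, hs, hli⟩ := exists_linearIndependent F (L : Set V)
  rw [hL.span_eq_top] at hs
  let b : Module.Basis s F V := Module.Basis.mk hli (by simpa using hs.ge)
  have hb : ∀ i, b i ∈ L := fun i => by simpa [b] using hsL i.2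
  have : Finite s := Module.Finite.finite_basis b
  have := Fintype.ofFinite s
  obtain ⟨T, hT⟩ := hL.fg
  have hTL : ∀ t ∈ T, t ∈ L := fun t ht => hT ▸ Submodule.subset_span ht
  rw [localLattice_eq_span hT, Submodule.mem_span_image_finset_iff_exists_fun] at hy
  obtain ⟨a, ha⟩ := hy
  have hr := fun t : T => exists_approx v (a t).2 fun i =>
    algebraMap F (v.adicCompletion F) (b.coord i t)
  choose r hrint hr2 using hr
  have hcoord : ∀ i, algebraMap F (v.adicCompletion F) (b.coord i (y - ∑ t, r t • (t : V))) ∈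
      v.adicCompletionIntegers F := by
    intro i
    -- The map applied is `c ⊗ x ↦ c * b.coord i x`, the `i`-th coordinate over the completion.
    have h := congrArg (TensorProduct.lift ((LinearMap.mul F (v.adicCompletion F)).compr₂
      LinearMap.id |>.compl₂ (Algebra.linearMap F (v.adicCompletion F) ∘ₗ b.coord i))) ha
    have hsmul : ∀ t, a t • ((1 : v.adicCompletion F) ⊗ₜ[F] (t : V)) =
        (a t : v.adicCompletion F) ⊗ₜ[F] (t : V) := by
      intro t
      rw [TensorProduct.smul_tmul', Algebra.smul_def, mul_one]
      rfl
    simp only [hsmul, map_sum, TensorProduct.lift.tmul, LinearMap.compl₂_apply,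
      LinearMap.compr₂_apply, LinearMap.mul_apply', LinearMap.comp_apply, LinearMap.id_apply,
      Algebra.linearMap_apply, one_mul] at h
    rw [map_sub, map_sub, ← h, map_sum, map_sum, ← Finset.sum_sub_distrib]
    refine sum_mem fun t _ => ?_
    rw [map_smul, smul_eq_mul, map_mul, ← sub_mul]
    exact hr2 t i
  have hyP : y = ∑ i, b.coord i (y - ∑ t, r t • (t : V)) • b i + ∑ t, r t • (t : V) := by
    simp only [Module.Basis.coord_apply]
    rw [b.sum_repr, sub_add_cancel]
  change y ∈ P
  rw [hyP]
  exact add_mem (sum_mem fun i _ => hP _ (hcoord i) _ (hb i))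
    (sum_mem fun t _ => hP _ (hrint t) _ (hTL t t.2))

/-- The ideal of all `r` with `r • y ∈ L` is nonzero because `L` spans, so a maximal ideal
containing it would be a place; descent at that place gives an element of the ideal outside it. -/
lemma mem_of_forall_tmul_mem_localLattice {L : Submodule R V} (hL : L.IsLattice F) {y : V}
    (hy : ∀ v : HeightOneSpectrum R,
      (1 : v.adicCompletion F) ⊗ₜ[F] y ∈ localLattice (F := F) L v) : y ∈ L := by
  let I : Ideal R := L.comap (LinearMap.toSpanSingleton R V y)
  have hI : ∀ r, r ∈ I ↔ r • y ∈ L := fun r => by simp [I]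
  by_contra hyL
  have hItop : I ≠ ⊤ := fun h => hyL (by simpa using (hI 1).1 (h ▸ Submodule.mem_top))
  have hIbot : I ≠ ⊥ := by
    obtain ⟨t, ht⟩ := multiple_mem_span_of_mem_localization_span (nonZeroDivisors R) F
      (L : Set V) y (hL.span_eq_top ▸ Submodule.mem_top)
    rw [Submodule.span_eq] at ht
    intro h
    have : (t : R) ∈ I := (hI _).2 ht
    rw [h, Submodule.mem_bot] at this
    exact nonZeroDivisors.ne_zero t.2 this
  obtain ⟨m, hm, hIm⟩ := Ideal.exists_le_maximal I hItop
  obtain ⟨s, hs, hsy⟩ := exists_smul_mem_of_tmul_mem_localLattice hL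
    ⟨m, hm.isPrime, fun h => hIbot (le_bot_iff.1 (h ▸ hIm))⟩ (hy _)
  exact hs (hIm ((hI s).2 hsy))

/-- A lattice is determined by its local completions. -/
lemma eq_of_forall_localLattice_eq {K L : Submodule R V} (hK : K.IsLattice F) (hL : L.IsLattice F)
    (h : ∀ v : HeightOneSpectrum R, localLattice (F := F) K v = localLattice (F := F) L v) :
    K = L :=
  le_antisymm
    (fun _ hx => mem_of_forall_tmul_mem_localLattice hL fun v => h v ▸ tmul_mem_localLattice hx)
    (fun _ hx => mem_of_forall_tmul_mem_localLattice hK fun v => h v ▸ tmul_mem_localLattice hx)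

end Lattice

/-! ### Continuity of conjugation in the Clifford algebra. -/

section CliffordTopology

open scoped Topology

open CliffordAlgebra

lemma star_mul_ι_mul {K W : Type*} [Field K] [AddCommGroup W] [Module K W]
    {Q : QuadraticForm K W} {x : CliffordAlgebra Q}
    (hx : x ∈ spinGroup Q) {y z : W} (h : x * ι Q y * star x = ι Q z) :
    star x * ι Q z * x = ι Q y := by
  rw [← h]
  calc star x * (x * ι Q y * star x) * x = (star x * x) * ι Q y * (star x * x) := by
        simp only [mul_assoc]
    _ = ι Q y := by rw [spinGroup.star_mul_self_of_mem hx, one_mul, mul_one]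

variable {O K W : Type*} [CommRing O] [Field K] [Algebra O K]
  [TopologicalSpace K] [IsTopologicalRing K]
  [AddCommGroup W] [Module K W] [FiniteDimensional K W] [Module O W] [IsScalarTower O K W]

lemma isOpen_cliffordOrder (hO : IsOpen ((algebraMap O K).range : Set K))
    (Q : QuadraticForm K W) {s : Set W} (hs : Submodule.span K s = ⊤) :
    IsOpen[moduleTopology K (CliffordAlgebra Q)]
      (cliffordOrder O Q s : Set (CliffordAlgebra Q)) := by
  let _ : TopologicalSpace (CliffordAlgebra Q) := moduleTopology K (CliffordAlgebra Q)
  have : IsModuleTopology K (CliffordAlgebra Q) := ⟨rfl⟩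
  exact isOpen_of_span_eq_top hO (Subalgebra.toSubmodule (cliffordOrder O Q s))
    (span_cliffordOrder Q hs)

variable [Invertible (2 : K)]

/-- Elements of the Clifford algebra close to `g` conjugate the vector `w` into an open
`O`-submodule `N` as soon as `g` does so. -/
lemma exists_isOpen_forall_conj_mem (hO : IsOpen ((algebraMap O K).range : Set K))
    (Q : QuadraticForm K W) (N : Submodule O W) (hN : Submodule.span K (N : Set W) = ⊤)
    (w : W) {g : CliffordAlgebra Q} {z : W} (hz : z ∈ N) (hg : g * ι Q w * star g = ι Q z) :
    ∃ U : Set (CliffordAlgebra Q), IsOpen[moduleTopology K (CliffordAlgebra Q)] U ∧ g ∈ U ∧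
      ∀ x ∈ U, ∀ y, x * ι Q w * star x = ι Q y → y ∈ N := by
  let _ : TopologicalSpace (CliffordAlgebra Q) := moduleTopology K (CliffordAlgebra Q)
  have : IsModuleTopology K (CliffordAlgebra Q) := ⟨rfl⟩
  have : ContinuousAdd (CliffordAlgebra Q) := IsModuleTopology.toContinuousAdd K _
  let _ : TopologicalSpace W := moduleTopology K W
  have : IsModuleTopology K W := ⟨rfl⟩
  have : ContinuousAdd W := IsModuleTopology.toContinuousAdd K W
  have hmul : Continuous fun ab : CliffordAlgebra Q × CliffordAlgebra Q => ab.1 * ab.2 :=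
    IsModuleTopology.continuous_mul_of_finite K (CliffordAlgebra Q)
  have hstar : Continuous fun x : CliffordAlgebra Q => star x :=
    IsModuleTopology.continuous_of_linearMap (R := K)
      ((reverse (Q := Q)) ∘ₗ (involute (Q := Q)).toLinearMap)
  have hconj : Continuous fun x : CliffordAlgebra Q => x * ι Q w * star x :=
    hmul.comp ((hmul.comp (continuous_id.prodMk continuous_const)).prodMk hstar)
  -- A linear left inverse of `ι` recovers the conjugated vector continuously, so its membership in
  -- the open module `N` is an open condition on `x`.
  obtain ⟨p, hp⟩ := (ι Q).exists_leftInverse_of_injective (LinearMap.ker_eq_bot.2 (ι_injective Q))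
  have hpι : ∀ y, p (ι Q y) = y := fun y => LinearMap.congr_fun hp y
  have hpc : Continuous p := IsModuleTopology.continuous_of_linearMap (R := K) p
  refine ⟨_, (isOpen_of_span_eq_top hO N hN).preimage (hpc.comp hconj), ?_, fun x hx y hy => ?_⟩
  · simpa [hg, hpι] using hz
  · simpa [hy, hpι] using hx

lemma exists_isOpen_forall_star_conj_mem (hO : IsOpen ((algebraMap O K).range : Set K))
    (Q : QuadraticForm K W) (N : Submodule O W) (hN : Submodule.span K (N : Set W) = ⊤)
    (w : W) {g : CliffordAlgebra Q} {z : W} (hz : z ∈ N) (hg : star g * ι Q w * g = ι Q z) :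
    ∃ U : Set (CliffordAlgebra Q), IsOpen[moduleTopology K (CliffordAlgebra Q)] U ∧ g ∈ U ∧
      ∀ x ∈ U, ∀ y, star x * ι Q w * x = ι Q y → y ∈ N := by
  obtain ⟨U, hU, hgU, h⟩ := exists_isOpen_forall_conj_mem hO Q N hN w (g := star g) hz
    (by rwa [star_star])
  let _ : TopologicalSpace (CliffordAlgebra Q) := moduleTopology K (CliffordAlgebra Q)
  have : IsModuleTopology K (CliffordAlgebra Q) := ⟨rfl⟩
  have : ContinuousAdd (CliffordAlgebra Q) := IsModuleTopology.toContinuousAdd K _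
  have hstar : Continuous fun x : CliffordAlgebra Q => star x :=
    IsModuleTopology.continuous_of_linearMap (R := K)
      ((reverse (Q := Q)) ∘ₗ (involute (Q := Q)).toLinearMap)
  exact ⟨_, hU.preimage hstar, hgU, fun x hx y hy => h (star x) hx y (by rwa [star_star])⟩

end CliffordTopology

/-! ### Action of the local spin groups on local lattices. -/

section Local

open CliffordAlgebra

variable {R F V : Type*} [CommRing R] [IsDedekindDomain R] [Field F] [Algebra R F]
  [IsFractionRing R F] [Invertible (2 : F)] [AddCommGroup V] [Module F V]
  (Q : QuadraticForm F V)

instance invertibleTwoAdicCompletion (v : HeightOneSpectrum R) :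
    Invertible (2 : v.adicCompletion F) :=
  (Invertible.map (algebraMap F (v.adicCompletion F)) 2).copy 2 (map_ofNat _ _).symm

/-- An element of the local spin group, as a point of `G(F_v)`. -/
def LocalSpin.mk {Q : QuadraticForm F V} {v : HeightOneSpectrum R}
    (x : CliffordAlgebra (localForm Q v)) (hx : x ∈ spinGroup (localForm Q v)) : LocalSpin Q v :=
  (⟨x, hx⟩ : spinGroup (localForm Q v))

lemma LocalSpin.val_mem {Q : QuadraticForm F V} {v : HeightOneSpectrum R} (g : LocalSpin Q v) :
    g.val ∈ spinGroup (localForm Q v) :=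
  Subtype.prop g

/-- In the form `h * ι y = ι (σ y) * h` the relation involves no `star`, so it passes through the
algebra map of base change directly. -/
lemma ofBaseChange_mul_ι_mul_star [FiniteDimensional F V] {h : CliffordAlgebra Q}
    (hh : h ∈ spinGroup Q) {σ : specialOrthogonal Q}
    (hσ : ∀ y, h * ι Q y * star h = ι Q ((σ : V ≃ₗ[F] V) y))
    {v : HeightOneSpectrum R} {x : LocalSpin Q v}
    (hx : x.val = ofBaseChange (v.adicCompletion F) Q (1 ⊗ₜ[F] h)) (y : LocalSpace F V v) :
    x.val * ι (localForm Q v) y * star x.val = ι (localForm Q v)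
      ((diagonal Q σ v : LocalSpace F V v ≃ₗ[v.adicCompletion F] LocalSpace F V v) y) := by
  induction y using TensorProduct.induction_on with
  | zero => simp only [map_zero, mul_zero, zero_mul]
  | add y z hy hz => simp only [map_add, mul_add, add_mul, hy, hz]
  | tmul c y =>
    have h1 : h * ι Q y = ι Q ((σ : V ≃ₗ[F] V) y) * h := by
      rw [← hσ, mul_assoc, spinGroup.star_mul_self_of_mem hh, mul_one]
    have h2 : x.val * ι (localForm Q v) (c ⊗ₜ[F] y) =
        ι (localForm Q v) (c ⊗ₜ[F] (σ : V ≃ₗ[F] V) y) * x.val := by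
      rw [hx, ← ofBaseChange_tmul_ι, ← ofBaseChange_tmul_ι, ← map_mul, ← map_mul,
        Algebra.TensorProduct.tmul_mul_tmul, Algebra.TensorProduct.tmul_mul_tmul, h1, one_mul,
        mul_one]
    rw [h2, mul_assoc, spinGroup.mul_star_self_of_mem (LocalSpin.val_mem x), mul_one]
    rfl

variable [Module R V]

lemma localImage_mul_eq_map (L : Submodule R V) (v : HeightOneSpectrum R)
    (σ τ : specialOrthogonal (localForm Q v)) :
    localImage Q L v (σ * τ) = (localImage Q L v τ).map
      (((σ : LocalSpace F V v ≃ₗ[v.adicCompletion F] LocalSpace F V v) :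
        LocalSpace F V v →ₗ[v.adicCompletion F] LocalSpace F V v).restrictScalars
          (v.adicCompletionIntegers F)) := by
  rw [localImage, localImage, ← Submodule.map_comp]
  rfl

lemma span_localImage {L : Submodule R V} (hL : Submodule.span F (L : Set V) = ⊤)
    (v : HeightOneSpectrum R) (σ : specialOrthogonal (localForm Q v)) :
    Submodule.span (v.adicCompletion F) (localImage Q L v σ : Set (LocalSpace F V v)) = ⊤ := by
  have h := Submodule.map_span ((σ : LocalSpace F V v ≃ₗ[v.adicCompletion F] LocalSpace F V v) :
        LocalSpace F V v →ₗ[v.adicCompletion F] LocalSpace F V v)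
    (localLattice (F := F) L v : Set (LocalSpace F V v))
  rw [span_localLattice hL, Submodule.map_top, LinearEquiv.range] at h
  exact h.symm

lemma localImage_le_iff {L : Submodule R V} [IsScalarTower R F V] {s : Set V}
    (hs : Submodule.span R s = L) (v : HeightOneSpectrum R)
    (σ : specialOrthogonal (localForm Q v))
    (N : Submodule (v.adicCompletionIntegers F) (LocalSpace F V v)) :
    localImage Q L v σ ≤ N ↔ ∀ t ∈ s,
      (σ : LocalSpace F V v ≃ₗ[v.adicCompletion F] LocalSpace F V v) (1 ⊗ₜ[F] t) ∈ N := by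
  rw [localImage, localLattice_eq_span hs, Submodule.map_span, Submodule.span_le,
    Set.image_image, Set.image_subset_iff]
  rfl

/-- At a place where the lattice is integral and self-dual, the integral points of the spin group
stabilize it. -/
lemma localImage_eq_of_mem_localSpinIntegral {L : Submodule R V} {v : HeightOneSpectrum R}
    (hfg : (Subalgebra.toSubmodule (cliffordOrder (v.adicCompletionIntegers F) (localForm Q v)
        (localLattice (F := F) L v : Set (LocalSpace F V v)))).FG)
    (hdual : ∀ x : LocalSpace F V v,
      (∀ y ∈ localLattice (F := F) L v, QuadraticMap.polar (localForm Q v) x y ∈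
        (algebraMap (v.adicCompletionIntegers F) (v.adicCompletion F)).range) →
      x ∈ localLattice (F := F) L v)
    {x : LocalSpin Q v} (hx : x ∈ localSpinIntegral Q L v)
    {τ : specialOrthogonal (localForm Q v)}
    (hτ : ∀ y, x.val * ι (localForm Q v) y * star x.val = ι (localForm Q v)
      ((τ : LocalSpace F V v ≃ₗ[v.adicCompletion F] LocalSpace F V v) y)) :
    localImage Q L v τ = localLattice L v := by
  apply le_antisymm
  · rintro _ ⟨y, hy, rfl⟩
    exact mem_of_mul_ι_mul_star_mem (localForm Q v) hfg hdual hx hy (hτ y)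
  · intro z hz
    let e := (τ : LocalSpace F V v ≃ₗ[v.adicCompletion F] LocalSpace F V v)
    refine ⟨e.symm z, ?_, e.apply_symm_apply _⟩
    -- The inverse of `x` is `star x`, which lies in the same order, so the first inclusion applies
    -- to it.
    refine mem_of_mul_ι_mul_star_mem (localForm Q v) hfg hdual
      (star_mem_cliffordOrder _ hx) hz ?_
    rw [star_star]
    refine star_mul_ι_mul (LocalSpin.val_mem x) ?_
    rw [hτ]
    exact congrArg _ (e.apply_symm_apply _)

variable [FiniteDimensional F V]

lemma isOpen_localSpinIntegral {L : Submodule R V} (hL : Submodule.span F (L : Set V) = ⊤)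
    (v : HeightOneSpectrum R) : IsOpen (localSpinIntegral Q L v) :=
  ⟨_, isOpen_cliffordOrder (isOpen_range_algebraMap_integers v) (localForm Q v)
    (span_localLattice hL v), rfl⟩

lemma localLattice_map (L : Submodule R V) [IsScalarTower R F V] (v : HeightOneSpectrum R)
    (σ : specialOrthogonal Q) :
    localLattice (F := F) (L.map (((σ : V ≃ₗ[F] V) : V →ₗ[F] V).restrictScalars R)) v =
      localImage Q L v (diagonal Q σ v) := by
  rw [localImage, localLattice, localLattice, Submodule.map_span, Submodule.map_coe,
    Set.image_image, Set.image_image]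
  rfl

/-- Elements of the local spin group close to `g` act on the local lattice as `g` does. -/
lemma exists_isOpen_forall_localImage_eq {L : Submodule R V} [IsScalarTower R F V]
    (hL : L.IsLattice F) (v : HeightOneSpectrum R) (g : LocalSpin Q v)
    (σ : specialOrthogonal (localForm Q v))
    (hg : ∀ y, g.val * ι (localForm Q v) y * star g.val = ι (localForm Q v)
      ((σ : LocalSpace F V v ≃ₗ[v.adicCompletion F] LocalSpace F V v) y)) :
    ∃ U : Set (LocalSpin Q v), IsOpen U ∧ g ∈ U ∧
      ∀ x ∈ U, ∀ τ : specialOrthogonal (localForm Q v),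
        (∀ y, x.val * ι (localForm Q v) y * star x.val = ι (localForm Q v)
          ((τ : LocalSpace F V v ≃ₗ[v.adicCompletion F] LocalSpace F V v) y)) →
        localImage Q L v τ = localImage Q L v σ := by
  obtain ⟨T, hT⟩ := hL.fg
  have hO := isOpen_range_algebraMap_integers (F := F) v
  have hTL : ∀ t : T, (1 : v.adicCompletion F) ⊗ₜ[F] (t : V) ∈ localLattice (F := F) L v :=
    fun t => tmul_mem_localLattice (hT ▸ Submodule.subset_span t.2)
  -- Each inclusion is tested on the finitely many generators: `x` must send `t` into `σ L_v`, and
  -- `star x` must send `σ t` back into `L_v`.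
  have h1 := fun t : T => exists_isOpen_forall_conj_mem hO (localForm Q v) (localImage Q L v σ)
    (span_localImage Q hL.span_eq_top v σ) (1 ⊗ₜ[F] (t : V))
    (Submodule.mem_map_of_mem (hTL t)) (hg _)
  have h2 := fun t : T => exists_isOpen_forall_star_conj_mem hO (localForm Q v)
    (localLattice (F := F) L v) (span_localLattice hL.span_eq_top v) _
    (hTL t) (star_mul_ι_mul (LocalSpin.val_mem g) (hg _))
  choose U1 hU1 hgU1 hx1 using h1
  choose U2 hU2 hgU2 hx2 using h2
  refine ⟨⋂ t, (LocalSpin.val ⁻¹' U1 t ∩ LocalSpin.val ⁻¹' U2 t),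
    isOpen_iInter_of_finite fun t => IsOpen.inter ⟨_, hU1 t, rfl⟩ ⟨_, hU2 t, rfl⟩,
    Set.mem_iInter.2 fun t => ⟨hgU1 t, hgU2 t⟩, fun x hx τ hτ => le_antisymm ?_ ?_⟩
  · rw [localImage_le_iff Q hT]
    exact fun t ht => hx1 ⟨t, ht⟩ _ (Set.mem_iInter.1 hx ⟨t, ht⟩).1 _ (hτ _)
  · rw [localImage_le_iff Q hT]
    intro t ht
    let e := (τ : LocalSpace F V v ≃ₗ[v.adicCompletion F] LocalSpace F V v)
    refine ⟨e.symm ((σ : LocalSpace F V v ≃ₗ[v.adicCompletion F] LocalSpace F V v) (1 ⊗ₜ[F] t)),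
      hx2 ⟨t, ht⟩ _ (Set.mem_iInter.1 hx ⟨t, ht⟩).2 _ (star_mul_ι_mul (LocalSpin.val_mem x) ?_),
      e.apply_symm_apply _⟩
    rw [hτ]
    exact congrArg _ (e.apply_symm_apply _)

end Local

/-! ### Strong approximation and comparison of classes with spinor genera. -/

section Global

lemma isLattice_map {R F V : Type*} [CommRing R] [Field F] [Algebra R F] [AddCommGroup V]
    [Module F V] [Module R V] [IsScalarTower R F V] {L : Submodule R V}
    (hL : L.IsLattice F) (σ : V ≃ₗ[F] V) :
    (L.map ((σ : V →ₗ[F] V).restrictScalars R)).IsLattice F where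
  fg := hL.fg.map _
  span_eq_top := by
    have h := Submodule.map_span (σ : V →ₗ[F] V) (L : Set V)
    rw [hL.span_eq_top, Submodule.map_top, LinearEquiv.range] at h
    exact h.symm
open CliffordAlgebra

variable {R F V : Type*} [CommRing R] [IsDedekindDomain R] [Field F] [Algebra R F]
  [IsFractionRing R F] [Invertible (2 : F)] [AddCommGroup V] [Module F V] [Module R V]
  [IsScalarTower R F V] [FiniteDimensional F V] {Q : QuadraticForm F V}

/-- Strong approximation: an adelic family of trivial spinor norm acts on a lattice as some
global rotation does. -/
lemma exists_localImage_diagonal_eq (hQ : Q.Nondegenerate) (hG : SpinStrongApproximation R Q)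
    {L : Submodule R V} (hL : L.IsLattice F)
    {γ : ∀ v : HeightOneSpectrum R, specialOrthogonal (localForm Q v)}
    (hγ : γ ∈ adelicSpinorKernel Q L) :
    ∃ σ : specialOrthogonal Q, ∀ v : HeightOneSpectrum R,
      localImage Q L v (diagonal Q σ v) = localImage Q L v (γ v) := by
  classical
  obtain ⟨M, hM, hdense⟩ := hG
  obtain ⟨hγL, hγ1⟩ := hγ
  have hgood := ((show ∀ᶠ v in Filter.cofinite, localImage Q L v (γ v) = localLattice L v from
    hγL).and (eventually_localLattice_eq hL hM)).and
    ((eventually_fg_cliffordOrder Q hM.fg).and (eventually_self_dual hQ hM.span_eq_top))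
  have hlift := fun v => exists_mem_spinGroup_of_one_mem_spinorNorm (hγ1 v)
  choose g hg hgγ using hlift
  have hnhds := fun v => exists_isOpen_forall_localImage_eq Q hL v
    (LocalSpin.mk (g v) (hg v)) (γ v) (hgγ v)
  choose U hUo hgU hU using hnhds
  let good : Set (HeightOneSpectrum R) := {v | (localImage Q L v (γ v) = localLattice L v ∧
    localLattice (F := F) M v = localLattice (F := F) L v) ∧
    (Subalgebra.toSubmodule (cliffordOrder (v.adicCompletionIntegers F) (localForm Q v)
        (localLattice (F := F) M v : Set (LocalSpace F V v)))).FG ∧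
    ∀ x : LocalSpace F V v,
      (∀ y ∈ localLattice (F := F) M v, QuadraticMap.polar (localForm Q v) x y ∈
        (algebraMap (v.adicCompletionIntegers F) (v.adicCompletion F)).range) →
      x ∈ localLattice (F := F) M v}
  have hfin : goodᶜ.Finite := hgood
  have hone : ∀ v, LocalSpin.mk 1 (one_mem (spinGroup (localForm Q v))) ∈ localSpinIntegral Q M v :=
    fun v => one_mem (cliffordOrder (v.adicCompletionIntegers F) (localForm Q v)
        (localLattice (F := F) M v : Set (LocalSpace F V v)))
  -- At good places the lift of `γ_v` need not be an integral point, so 1 is used there; this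
  -- suffices because `γ_v` already stabilizes `L_v`.
  let f₀ : AdelicSpin Q M := ⟨fun v => if v ∈ good then
      LocalSpin.mk 1 (one_mem (spinGroup (localForm Q v))) else LocalSpin.mk (g v) (hg v), by
      filter_upwards [hgood] with v hv
      rw [if_pos (show v ∈ good from hv)]
      exact hone v⟩
  -- Integrality at all good places is open in the restricted product, and only finitely many
  -- further conditions are imposed.
  let Ω : Set (AdelicSpin Q M) := {f | ∀ v, v ∈ good → f v ∈ localSpinIntegral Q M v} ∩
    ⋂ v ∈ goodᶜ, {f | f v ∈ U v}
  have hΩ : IsOpen Ω :=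
    (RestrictedProduct.isOpen_forall_imp_mem
      fun v => isOpen_localSpinIntegral Q hM.span_eq_top v).inter
    (hfin.isOpen_biInter fun v _ => (hUo v).preimage (RestrictedProduct.continuous_eval v))
  have hf₀ : f₀ ∈ Ω := by
    refine ⟨fun v hv => ?_, Set.mem_iInter₂.2 fun v hv => ?_⟩
    · rw [show f₀ v = _ from if_pos hv]
      exact hone v
    · rw [Set.mem_ofPred_eq, show f₀ v = _ from if_neg hv]
      exact hgU v
  obtain ⟨f, ⟨h, hh, hfh⟩, hf1, hf2⟩ := hdense.exists_mem_open hΩ ⟨f₀, hf₀⟩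
  obtain ⟨σ, hσ⟩ := exists_specialOrthogonal_of_mem_spinGroup hh
  refine ⟨σ, fun v => ?_⟩
  have hv := ofBaseChange_mul_ι_mul_star Q hh hσ (hfh v)
  -- At a good place `σ` and `γ_v` both stabilize `L_v = M_v`; at a bad place closeness to the lift
  -- gives the equality.
  by_cases hvg : v ∈ good
  · have h1 := localImage_eq_of_mem_localSpinIntegral Q hvg.2.1 hvg.2.2 (hf1 v hvg) hv
    rw [localImage, hvg.1.2] at h1
    rw [hvg.1.1, localImage, h1]
  · exact hU v _ (Set.mem_iInter₂.1 hf2 v hvg) _ hv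

lemma properClass_subset_properSpinorGenus {L : Submodule R V} (hL : L.IsLattice F) :
    properClass Q L ⊆ properSpinorGenus Q L := by
  rintro _ ⟨σ, rfl⟩
  refine ⟨σ, 1, ⟨one_mem _, fun v => ⟨[], by simp, rfl, 1, by simp⟩⟩, isLattice_map hL _,
    fun v => ?_⟩
  rw [mul_one, localLattice_map]

/-- Under strong approximation for the spin group, proper classes and proper spinor genera
coincide. -/
lemma properClass_eq_properSpinorGenus (hQ : Q.Nondegenerate) (hG : SpinStrongApproximation R Q)
    {L : Submodule R V} (hL : L.IsLattice F) : properClass Q L = properSpinorGenus Q L := by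
  refine (properClass_subset_properSpinorGenus hL).antisymm ?_
  rintro K ⟨α, γ, hγ, hK, hKv⟩
  obtain ⟨σ, hσ⟩ := exists_localImage_diagonal_eq hQ hG hL hγ
  refine ⟨α * σ, eq_of_forall_localLattice_eq hK (isLattice_map hL _) fun v => ?_⟩
  have hmap : L.map ((((α * σ : specialOrthogonal Q) : V ≃ₗ[F] V) : V →ₗ[F] V).restrictScalars R) =
      (L.map (((σ : V ≃ₗ[F] V) : V →ₗ[F] V).restrictScalars R)).map
        (((α : V ≃ₗ[F] V) : V →ₗ[F] V).restrictScalars R) := by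
    rw [← Submodule.map_comp]
    rfl
  rw [hKv, Pi.mul_apply, localImage_mul_eq_map, ← hσ, hmap, localLattice_map, ← localLattice_map,
    localImage]

end Global

end QuadLattice

end

open QuadLattice in
theorem theorem3p2 {R F V : Type*} [CommRing R] [IsDedekindDomain R] [Field F] [Algebra R F]
    [IsFractionRing R F] [Invertible (2 : F)] [AddCommGroup V] [Module F V] [Module R V]
    [IsScalarTower R F V] [FiniteDimensional F V]
    (Q : QuadraticForm F V) (hQ : Q.Nondegenerate)
    (hdim : 3 ≤ Module.finrank F V) (hG : SpinStrongApproximation R Q)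
    (L : Submodule R V) (hL : L.IsLattice F) :
    properClass Q L = properSpinorGenus Q L ∧
      properClassNumber Q L = properSpinorClassNumber Q L := by
  refine ⟨properClass_eq_properSpinorGenus hQ hG hL, ?_⟩
  rw [properClassNumber, properSpinorClassNumber]
  congr 1
  -- Members of the genus are themselves lattices, so the equality of orbits holds for each of them
  -- and both counts are of the same set.
  refine Set.image_congr fun K hK => ?_
  obtain ⟨_, _, hKL, _⟩ := hK
  exact properClass_eq_properSpinorGenus hQ hG hKL
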